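/- For each $n$ let $\Sigma_n\subset\mathbb R^n$ be either the hypercube $\{-1,1\}^n$ or the sphere of radius $\sqrt n$ centred at the origin, with its Borel $\sigma$-algebra, and let $\mu_n$ be a random probability measure on $\Sigma_n$ (the Gibbs measure of a spin glass model), defined on some probability space. For $\sigma,\tau\in\Sigma_n$ let $R(\sigma,\tau)=\frac1n\sum_{i=1}^n\sigma_i\tau_i\in[-1,1]$ be their overlap, and write $R_{i,j}=R(\sigma^i,\sigma^j)$, where $\sigma^1,\sigma^2,\sigma^3$ are i.i.d. with law $\mu_n$ given $\mu_n$. Let $\langle\cdot\rangle$ denote expectation over these configurations for fixed $\mu_n$, and $\mathbb E$ expectation over the randomness of $\mu_n$. A *hierarchical clustering* of $\Sigma_n$ consists of a finite rooted tree and, for each node $\alpha$ of it, a nonempty measurable set $C_\alpha\subseteq\Sigma_n$ (the cluster of $\alpha$), such that the cluster of the root is $\Sigma_n$, the cluster of a node is contained in the clusters of its ancestors, and two nodes neither of which is an ancestor of the other have disjoint clusters. (A node may carry the same set as its parent.) The depth of $\alpha$ is its distance to the root. For $\sigma,\tau\in\Sigma_n$, the smallest cluster $\alpha(\sigma,\tau)$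 containing $\sigma$ and $\tau$ is the lowest (that is, deepest) node whose cluster contains both; it exists and is unique. **Theorem.** Suppose that for some bounded measurable $f:[-1,1]\to\mathbb R$ the generalized Parisi ultrametricity ansatz holds: for every $\epsilon>0$, $$\lim_{n\to\infty}\mathbb E\big\langle \mathbf 1_{\{f(R_{1,2})\ge\min\{f(R_{1,3}),f(R_{2,3})\}-\epsilon\}}\big\rangle=1 .$$ Then there are deterministic sequences $\epsilon_n\to0$ and $\delta_n\to0$ such that for every $n$ there is an event of probability at least $1-\epsilon_n$ on which the following holds: there exist a hierarchical clustering of $\Sigma_n$ (depending on $\mu_n$) and real numbers $q_\alpha$, one for each node $\alpha$ and depending only on the depth of $\alpha$, such that $$\big\langle\,|f(R_{1,2})-q_{\alpha(\sigma^1,\sigma^2)}|\,\big\rangle\le\delta_n .$$ -/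

import Mathlib

open MeasureTheory ProbabilityTheory Filter Topology

noncomputable section

/-- The two kinds of spin configurations: Ising spins (the hypercube `{-1,1}ⁿ`) and spherical spins
(the sphere of radius `√n`). -/
inductive SpinKind : Type
  | ising
  | spherical

/-- The configuration space `Σₙ`: either the hypercube `{-1,1}ⁿ` or the sphere of radius `√n`
centred at the origin of `ℝⁿ`. As a type it carries the Borel σ-algebra inherited from `ℝⁿ`, which
for the hypercube is the power set. -/
def configSpace (k : SpinKind) (n : ℕ) : Set (EuclideanSpace ℝ (Fin n)) :=
  match k with
  | SpinKind.ising => {σ | ∀ i, σ i = -1 ∨ σ i = 1}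
  | SpinKind.spherical => Metric.sphere 0 (√(n : ℝ))

theorem configSpace_sum_sq {k : SpinKind} {n : ℕ} (σ : configSpace k n) :
    ∑ i, (σ : EuclideanSpace ℝ (Fin n)) i ^ 2 = n := by
  obtain ⟨σ, hσ⟩ := σ
  cases k with
  | ising =>
    have h : ∀ i, σ i ^ 2 = 1 := fun i => by
      rcases hσ i with h | h <;> rw [h] <;> norm_num
    simp [h]
  | spherical =>
    have h : ‖σ‖ = √(n : ℝ) := by simpa [configSpace] using hσ
    rw [← EuclideanSpace.real_norm_sq_eq, h, Real.sq_sqrt (Nat.cast_nonneg n)]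

theorem overlap_mem_Icc {k : SpinKind} {n : ℕ} (σ τ : configSpace k n) :
    (1 / (n : ℝ)) * ∑ i, (σ : EuclideanSpace ℝ (Fin n)) i * (τ : EuclideanSpace ℝ (Fin n)) i
      ∈ Set.Icc (-1 : ℝ) 1 := by
  rcases Nat.eq_zero_or_pos n with rfl | hn
  · simp
  · have hn' : (0 : ℝ) < n := Nat.cast_pos.mpr hn
    have hs := configSpace_sum_sq σ
    have ht := configSpace_sum_sq τ
    have h := Finset.sum_mul_sq_le_sq_mul_sq Finset.univ
      (fun i => (σ : EuclideanSpace ℝ (Fin n)) i) (fun i => (τ : EuclideanSpace ℝ (Fin n)) i)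
    rw [hs, ht, ← sq] at h
    have h' := abs_le.mp (abs_le_of_sq_le_sq h hn'.le)
    rw [one_div, inv_mul_eq_div]
    constructor
    · rw [le_div_iff₀ hn']; linarith [h'.1]
    · rw [div_le_iff₀ hn']; linarith [h'.2]

/-- The overlap `R = (1/n) ∑ᵢ σᵢ τᵢ ∈ [-1,1]` of two configurations. -/
def overlap {k : SpinKind} {n : ℕ} (σ τ : configSpace k n) : Set.Icc (-1 : ℝ) 1 :=
  ⟨(1 / (n : ℝ)) * ∑ i, (σ : EuclideanSpace ℝ (Fin n)) i * (τ : EuclideanSpace ℝ (Fin n)) i,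
    overlap_mem_Icc σ τ⟩

/-- The generalized Parisi ultrametricity ansatz for the sequence of random probability measures
`μ n ω` on `configSpace (k n) n`, with `ω` distributed according to `P n`: for every `ε > 0`,
`lim_{n → ∞} 𝔼⟨1{f(R₁₂) ≥ min(f(R₁₃), f(R₂₃)) - ε}⟩ = 1`, where under `⟨·⟩` the three
configurations are i.i.d. with law `μ n ω`. -/
def GeneralizedParisiAnsatz {Ω : ℕ → Type*} [∀ n, MeasurableSpace (Ω n)]
    (P : ∀ n, Measure (Ω n)) (k : ℕ → SpinKind)
    (μ : ∀ n, Kernel (Ω n) (configSpace (k n) n)) (f : Set.Icc (-1 : ℝ) 1 → ℝ) : Prop :=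
  ∀ ε : ℝ, 0 < ε →
    Tendsto
      (fun n => ∫ ω, (∫ s : configSpace (k n) n × configSpace (k n) n × configSpace (k n) n,
          Set.indicator
            {s | min (f (overlap s.1 s.2.2)) (f (overlap s.2.1 s.2.2)) - ε
              ≤ f (overlap s.1 s.2.1)}
            (fun _ => (1 : ℝ)) s
          ∂((μ n ω).prod ((μ n ω).prod (μ n ω)))) ∂(P n))
      atTop (𝓝 1)

/-- A hierarchical clustering of `S` into finitely many measurable clusters. The hierarchy is a
finite rooted tree, given by its ancestor order: `a ≤ b` means that `b` is `a` or an ancestor of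
`a`, the root is `⊤`, and the nodes above any node form a chain. The cluster of a node is nonempty
and contained in the clusters of its ancestors, nodes in different branches have disjoint clusters,
and the root carries the whole space. (A node may carry the same set as its parent.) -/
structure HierarchicalClustering (S : Type*) [MeasurableSpace S] where
  /-- The nodes of the hierarchy, which index the clusters. -/
  Node : Type
  [partialOrder : PartialOrder Node]
  [orderTop : OrderTop Node]
  [finite : Finite Node]
  isChain_Ici : ∀ a : Node, IsChain (· ≤ ·) (Set.Ici a)
  /-- The set of points that form the cluster of a node. -/
  cluster : Node → Set S
  measurableSet_cluster : ∀ a, MeasurableSet (cluster a)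
  nonempty_cluster : ∀ a, (cluster a).Nonempty
  cluster_top : cluster ⊤ = Set.univ
  cluster_subset : ∀ a b, a ≤ b → cluster a ⊆ cluster b
  disjoint_cluster : ∀ a b, ¬ a ≤ b → ¬ b ≤ a → Disjoint (cluster a) (cluster b)

namespace HierarchicalClustering

variable {S : Type*} [MeasurableSpace S] (H : HierarchicalClustering S)

instance : PartialOrder H.Node := H.partialOrder

instance : OrderTop H.Node := H.orderTop

instance : Finite H.Node := H.finite

/-- The depth of a node: the number of its strict ancestors, which is its distance to the root. -/
def depth (a : H.Node) : ℕ := (Set.Ioi a).ncard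

theorem exists_isLeast (x y : S) :
    ∃ a, IsLeast {a : H.Node | x ∈ H.cluster a ∧ y ∈ H.cluster a} a := by
  have hne : {a : H.Node | x ∈ H.cluster a ∧ y ∈ H.cluster a}.Nonempty :=
    ⟨⊤, by simp [H.cluster_top]⟩
  obtain ⟨a, ha⟩ := (Set.toFinite _).exists_minimal hne
  refine ⟨a, ha.prop, fun b hb => ?_⟩
  by_cases hab : a ≤ b
  · exact hab
  · by_cases hba : b ≤ a
    · exact ha.le_of_le hb hba
    · exact absurd hb.1
        (Set.disjoint_left.mp (H.disjoint_cluster a b hab hba) ha.prop.1)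

/-- The smallest cluster containing both `x` and `y`: the lowest node of the hierarchy whose cluster
contains both points. -/
def smallest (x y : S) : H.Node := (H.exists_isLeast x y).choose

theorem isLeast_smallest (x y : S) :
    IsLeast {a : H.Node | x ∈ H.cluster a ∧ y ∈ H.cluster a} (H.smallest x y) :=
  (H.exists_isLeast x y).choose_spec

end HierarchicalClustering

end

/-! Call two configurations related at threshold t when f(R) ≥ t. If ultrametricity were exact, this
relation would be transitive and its classes would shrink as t increases; they would form a tree,
and the depth at which two points separate would determine f(R) up to the spacing of the thresholds.
Here ultrametricity holds only up to a slack κ and outside a set of triples of small mass.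

The slack is absorbed by the choice of t: by pigeonhole, each interval of length w contains a t such
that f(R) is rarely just below t (`exists_threshold`). A failure of transitivity at this t is then
an ultrametric defect or that rare event (`measureReal_cherries_le`). The exceptional triples are
absorbed by `exists_classes`: an almost transitive symmetric relation agrees, up to small measure,
with membership in a common class of a finite disjoint family. Classes for different thresholds need
not be nested, so they are intersected successively (`commonRefinement`). For a pair on which every
family is correct, sharing a cluster of level j still means that f(R) passes the first j thresholds.

This gives `exists_isHierarchical`, a statement about one deterministic measure. Markov's inequality
passes to the random measure, and a diagonal choice yields the null sequences. -/

/-! ### Transitivity defects of a relation -/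

/-- The triples whose third point is related to the first two, while these are not related. -/
def cherries {S : Type*} (W : Set (S × S)) : Set (S × S × S) :=
  {s | (s.1, s.2.2) ∈ W ∧ (s.2.1, s.2.2) ∈ W ∧ (s.1, s.2.1) ∉ W}

/-- The triples in which exactly one of the three pairs is not related. -/
def transitivityDefects {S : Type*} (W : Set (S × S)) : Set (S × S × S) :=
  {s | (s.1, s.2.1) ∈ W ∧ (s.1, s.2.2) ∈ W ∧ (s.2.1, s.2.2) ∉ W} ∪
    ({s | (s.1, s.2.1) ∈ W ∧ (s.2.1, s.2.2) ∈ W ∧ (s.1, s.2.2) ∉ W} ∪ cherries W)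

/-- The relation of lying in a common member of `F`. -/
def sameMember {S : Type*} (F : Set (Set S)) : Set (S × S) := ⋃ A ∈ F, A ×ˢ A

theorem mem_sameMember {S : Type*} {F : Set (Set S)} {p : S × S} :
    p ∈ sameMember F ↔ ∃ A ∈ F, p.1 ∈ A ∧ p.2 ∈ A := by
  simp only [sameMember, Set.mem_iUnion, Set.mem_prod, exists_prop]

theorem measurableSet_sameMember {S : Type*} [MeasurableSpace S] {F : Set (Set S)}
    (hF : F.Finite) (hm : ∀ A ∈ F, MeasurableSet A) : MeasurableSet (sameMember F) :=
  hF.measurableSet_biUnion fun A hA => (hm A hA).prod (hm A hA)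

section

variable {S : Type*} [MeasurableSpace S]

theorem measureReal_prod_eq_integral {T : Type*} [MeasurableSpace T] (ν : Measure S)
    [IsFiniteMeasure ν] (ρ : Measure T) [IsFiniteMeasure ρ] {D : Set (S × T)}
    (hD : MeasurableSet D) :
    (ν.prod ρ).real D = ∫ x, ρ.real (Prod.mk x ⁻¹' D) ∂ν := by
  rw [Measure.real, Measure.prod_apply hD]
  exact (integral_toReal (measurable_measure_prodMk_left hD).aemeasurable
    (ae_of_all _ fun x => measure_lt_top _ _)).symm

theorem measurableSet_cherries {W : Set (S × S)} (hW : MeasurableSet W) :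
    MeasurableSet (cherries W) := by
  have h13 : Measurable fun s : S × S × S => (s.1, s.2.2) := by fun_prop
  have h23 : Measurable fun s : S × S × S => (s.2.1, s.2.2) := by fun_prop
  have h12 : Measurable fun s : S × S × S => (s.1, s.2.1) := by fun_prop
  exact (h13 hW).inter ((h23 hW).inter (h12 hW).compl)

theorem measurableSet_transitivityDefects {W : Set (S × S)} (hW : MeasurableSet W) :
    MeasurableSet (transitivityDefects W) := by
  have h13 : Measurable fun s : S × S × S => (s.1, s.2.2) := by fun_prop
  have h23 : Measurable fun s : S × S × S => (s.2.1, s.2.2) := by fun_prop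
  have h12 : Measurable fun s : S × S × S => (s.1, s.2.1) := by fun_prop
  exact ((h12 hW).inter ((h13 hW).inter (h23 hW).compl)).union
    (((h12 hW).inter ((h23 hW).inter (h13 hW).compl)).union (measurableSet_cherries hW))

/-- The three kinds of defect are permutations of one another by the symmetry of the relation, and
the product measure is invariant under permuting the coordinates. -/
theorem measureReal_transitivityDefects_le (ν : Measure S) [IsProbabilityMeasure ν]
    {W : Set (S × S)} (hW : MeasurableSet W) (hsymm : ∀ x y, (x, y) ∈ W → (y, x) ∈ W) :
    (ν.prod (ν.prod ν)).real (transitivityDefects W) ≤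
      3 * (ν.prod (ν.prod ν)).real (cherries W) := by
  have hc := (measurableSet_cherries hW).nullMeasurableSet (μ := ν.prod (ν.prod ν))
  have hs (x y : S) : (x, y) ∈ W ↔ (y, x) ∈ W := ⟨hsymm x y, hsymm y x⟩
  have h1 : MeasurePreserving (fun s : S × S × S => (s.2.1, s.2.2, s.1))
      (ν.prod (ν.prod ν)) (ν.prod (ν.prod ν)) :=
    (measurePreserving_prodAssoc ν ν ν).comp
      (Measure.measurePreserving_swap (μ := ν) (ν := ν.prod ν))
  have h2 : MeasurePreserving (fun s : S × S × S => (s.1, s.2.2, s.2.1))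
      (ν.prod (ν.prod ν)) (ν.prod (ν.prod ν)) :=
    (MeasurePreserving.id ν).prod (Measure.measurePreserving_swap (μ := ν) (ν := ν))
  have e1 : {s : S × S × S | (s.1, s.2.1) ∈ W ∧ (s.1, s.2.2) ∈ W ∧ (s.2.1, s.2.2) ∉ W} =
      (fun s : S × S × S => (s.2.1, s.2.2, s.1)) ⁻¹' cherries W := by
    ext s
    simp only [cherries, Set.mem_ofPred_eq, Set.mem_preimage]
    rw [hs s.1 s.2.1, hs s.1 s.2.2]
  have e2 : {s : S × S × S | (s.1, s.2.1) ∈ W ∧ (s.2.1, s.2.2) ∈ W ∧ (s.1, s.2.2) ∉ W} =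
      (fun s : S × S × S => (s.1, s.2.2, s.2.1)) ⁻¹' cherries W := by
    ext s
    simp only [cherries, Set.mem_ofPred_eq, Set.mem_preimage]
    rw [hs s.2.1 s.2.2]
  have m1 := h1.measureReal_preimage hc
  have m2 := h2.measureReal_preimage hc
  unfold transitivityDefects
  rw [e1, e2]
  refine (measureReal_union_le _ _).trans ?_
  have := measureReal_union_le (μ := ν.prod (ν.prod ν))
    ((fun s : S × S × S => (s.1, s.2.2, s.2.1)) ⁻¹' cherries W) (cherries W)
  linarith

/-! ### Almost transitive relations are nearly partitions -/

/-- A greedy choice of pivots splits `U` into classes, each a neighbourhood of its pivot, up to a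
set on which the relation is sparse. -/
theorem exists_classes_of_lt (ν : Measure S) [IsProbabilityMeasure ν] {W : Set (S × S)}
    (hW : MeasurableSet W) {θ l κ : ℝ} (hθ : 0 < θ)
    (hl : 0 < l) (hκ : (ν.prod (ν.prod ν)).real (transitivityDefects W) ≤ κ) (N : ℕ) :
    ∀ U : Set S, MeasurableSet U → ν.real U < N * θ →
      ∃ F : Set (Set S), F.Finite ∧ (∀ A ∈ F, MeasurableSet A) ∧
        (∀ A ∈ F, A ⊆ U) ∧ F.PairwiseDisjoint id ∧
        (ν.prod ν).real (symmDiff W (sameMember F) ∩ U ×ˢ U) ≤ N * l + (θ + κ / l) := by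
  have hD := measurableSet_transitivityDefects hW
  induction N with
  | zero =>
    intro U _ hU
    have := measureReal_nonneg (μ := ν) (s := U)
    simp at hU
    linarith
  | succ N ih =>
    intro U hUm hU
    -- A pivot must have few defects through it and a neighbourhood of mass at least `θ` in `U`.
    -- Each pivot uses up mass `θ`, so fewer than `N` can be chosen.
    by_cases h : ∃ z, (ν.prod ν).real (Prod.mk z ⁻¹' transitivityDefects W) ≤ l ∧
        θ ≤ ν.real (Prod.mk z ⁻¹' W ∩ U)
    · obtain ⟨z, hzl, hzθ⟩ := h
      set A := Prod.mk z ⁻¹' W ∩ U with hA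
      have hAm : MeasurableSet A := (measurable_prodMk_left hW).inter hUm
      have hAU : A ⊆ U := Set.inter_subset_right
      have hV : ν.real (U \ A) < N * θ := by
        rw [measureReal_sdiff hAU hAm]
        push_cast at hU
        linarith
      obtain ⟨F, hfin, hmeas, hsub, hdisj, hle⟩ := ih (U \ A) (hUm.diff hAm) hV
      refine ⟨insert A F, hfin.insert A, ?_, ?_, ?_, ?_⟩
      · rintro B (rfl | hB)
        exacts [hAm, hmeas B hB]
      · rintro B (rfl | hB)
        exacts [hAU, (hsub B hB).trans Set.sdiff_subset]
      · refine hdisj.insert fun B hB _ => ?_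
        exact Set.disjoint_left.mpr fun x hx hxB => (hsub B hB hxB).2 hx
      -- A wrongly classified pair with at least one point in `A` forms a defect together with `z`;
      -- all other pairs are left to the induction on `U \ A`.
      · have hcover : symmDiff W (sameMember (insert A F)) ∩ U ×ˢ U ⊆
            (Prod.mk z ⁻¹' transitivityDefects W) ∪
              (symmDiff W (sameMember F) ∩ (U \ A) ×ˢ (U \ A)) := by
          rintro ⟨x, y⟩ ⟨hxy, hx, hy⟩
          have hxA : x ∈ A ↔ (z, x) ∈ W := ⟨fun h => h.1, fun h => ⟨h, hx⟩⟩
          have hyA : y ∈ A ↔ (z, y) ∈ W := ⟨fun h => h.1, fun h => ⟨h, hy⟩⟩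
          have hxF : x ∈ A → (x, y) ∉ sameMember F := fun h h' => by
            obtain ⟨B, hB, hxB, -⟩ := mem_sameMember.mp h'
            exact (hsub B hB hxB).2 h
          have hyF : y ∈ A → (x, y) ∉ sameMember F := fun h h' => by
            obtain ⟨B, hB, -, hyB⟩ := mem_sameMember.mp h'
            exact (hsub B hB hyB).2 h
          have hins : (x, y) ∈ sameMember (insert A F) ↔
              (x ∈ A ∧ y ∈ A) ∨ (x, y) ∈ sameMember F := by
            simp [mem_sameMember]
          simp only [Set.mem_symmDiff, hins, Set.mem_union, Set.mem_preimage, transitivityDefects,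
            cherries, Set.mem_ofPred_eq, Set.mem_inter_iff, Set.mem_prod, Set.mem_sdiff] at hxy hx hy ⊢
          by_cases hzx : (z, x) ∈ W <;> by_cases hzy : (z, y) ∈ W
          · simp only [hxA, hyA, hzx, hzy, hxF (hxA.mpr hzx), true_and, and_true, or_false,
              not_true_eq_false, and_false, false_or] at hxy ⊢
            tauto
          · simp only [hxA, hyA, hzx, hzy, hxF (hxA.mpr hzx), true_and, and_true, or_false,
              and_false, false_or, not_false_eq_true, false_and] at hxy ⊢
            exact Or.inl hxy
          · simp only [hxA, hyA, hzx, hzy, hyF (hyA.mpr hzy), true_and, and_true, or_false,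
              false_or, not_false_eq_true, false_and] at hxy ⊢
            exact Or.inl hxy
          · simp only [hxA, hyA, hzx, hzy, false_and, false_or, not_false_eq_true, and_true] at hxy ⊢
            tauto
        refine (measureReal_mono hcover).trans ((measureReal_union_le _ _).trans ?_)
        push_cast
        linarith
    -- Without a pivot, a point either has a neighbourhood of mass below `θ` in `U` or has many
    -- defects through it. The latter points have mass at most `κ / l` by Markov, so the relation on
    -- `U` is sparse and no class is needed.
    · push Not at h
      refine ⟨∅, Set.finite_empty, by simp, by simp, by simp, ?_⟩
      have hemp : sameMember (∅ : Set (Set S)) = ∅ := by simp [sameMember]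
      set G : S → ℝ := fun z => (ν.prod ν).real (Prod.mk z ⁻¹' transitivityDefects W) with hG
      have hGm : Measurable G := (measurable_measure_prodMk_left hD).ennreal_toReal
      have hGi : Integrable G ν := by
        refine Integrable.of_bound hGm.aestronglyMeasurable 1 (ae_of_all _ fun z => ?_)
        rw [Real.norm_of_nonneg measureReal_nonneg]
        exact measureReal_le_one
      have hGint : ∫ z, G z ∂ν ≤ κ := by
        rw [← measureReal_prod_eq_integral ν (ν.prod ν) hD] 
        exact hκ
      have hbad : ν.real {z | l ≤ G z} ≤ κ / l := by
        rw [le_div_iff₀ hl, mul_comm]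
        exact (mul_meas_ge_le_integral_of_nonneg
          (ae_of_all _ fun z => measureReal_nonneg) hGi l).trans hGint
      have hWU : MeasurableSet (W ∩ U ×ˢ U) := hW.inter (hUm.prod hUm)
      have hbadm : MeasurableSet {z | l ≤ G z} := measurableSet_le measurable_const hGm
      have hcalc : (ν.prod ν).real (W ∩ U ×ˢ U) ≤ θ + κ / l := by
        rw [measureReal_prod_eq_integral ν ν hWU]
        calc ∫ z, ν.real (Prod.mk z ⁻¹' (W ∩ U ×ˢ U)) ∂ν
            ≤ ∫ z, (θ + {z | l ≤ G z}.indicator (fun _ => (1 : ℝ)) z) ∂ν := by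
              refine integral_mono ?_ ?_ fun z => ?_
              · refine Integrable.of_bound
                  (measurable_measure_prodMk_left hWU).ennreal_toReal.aestronglyMeasurable 1
                  (ae_of_all _ fun z => ?_)
                rw [Real.norm_of_nonneg measureReal_nonneg]
                exact measureReal_le_one
              · exact (integrable_const θ).add ((integrable_const 1).indicator hbadm)
              · by_cases hz : l ≤ G z
                · have : ν.real (Prod.mk z ⁻¹' (W ∩ U ×ˢ U)) ≤ 1 := measureReal_le_one
                  simp only [Set.indicator, Set.mem_ofPred_eq, hz, if_true]
                  linarith
                · have h1 := h z (le_of_not_ge hz)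
                  have h2 : ν.real (Prod.mk z ⁻¹' (W ∩ U ×ˢ U)) ≤
                      ν.real (Prod.mk z ⁻¹' W ∩ U) :=
                    measureReal_mono fun y hy => ⟨hy.1, hy.2.2⟩
                  simp only [Set.indicator, Set.mem_ofPred_eq, hz, if_false]
                  linarith
          _ = θ + ν.real {z | l ≤ G z} := by
              rw [integral_add (integrable_const θ) ((integrable_const 1).indicator hbadm),
                integral_indicator_const _ hbadm]
              simp
          _ ≤ θ + κ / l := by linarith
      have hset : symmDiff W (sameMember ∅) ∩ U ×ˢ U = W ∩ U ×ˢ U := by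
        rw [hemp, ← Set.bot_eq_empty, symmDiff_bot]
      rw [hset]
      have : 0 ≤ ((N + 1 : ℕ) : ℝ) * l := by positivity
      linarith

end

/-- A symmetric relation with few transitivity defects is close to the relation of lying in a common
member of a finite disjoint family. -/
theorem exists_classes {e : ℝ} (he : 0 < e) :
    ∃ κ : ℝ, 0 < κ ∧ ∀ (S : Type*) [MeasurableSpace S] (ν : Measure S) [IsProbabilityMeasure ν]
      (W : Set (S × S)), MeasurableSet W → (∀ x y, (x, y) ∈ W → (y, x) ∈ W) →
      (ν.prod (ν.prod ν)).real (cherries W) ≤ κ →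
      ∃ F : Set (Set S), F.Finite ∧ (∀ A ∈ F, MeasurableSet A) ∧
        F.PairwiseDisjoint id ∧ (ν.prod ν).real (symmDiff W (sameMember F)) ≤ e := by
  obtain ⟨N, hN⟩ := exists_nat_gt (1 / (e / 3))
  have hθ : 0 < e / 3 := by positivity
  have hN0 : (0 : ℝ) < N := lt_trans (by positivity) hN
  have hl : 0 < e / (3 * N) := by positivity
  -- With `θ = e / 3`, `l = e / (3 * N)` and defect mass at most three times this constant, the
  -- terms `N * l`, `θ` and `κ / l` are `e / 3` each.
  refine ⟨e / (3 * N) * e / 9, by positivity, fun S _ ν _ W hW hsymm hκ => ?_⟩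
  have hD := (measureReal_transitivityDefects_le ν hW hsymm).trans
    (mul_le_mul_of_nonneg_left hκ (by norm_num : (0 : ℝ) ≤ 3))
  obtain ⟨F, h1, h2, -, h3, h4⟩ := exists_classes_of_lt ν hW hθ hl hD N Set.univ
    MeasurableSet.univ (by
      rw [div_lt_iff₀ hθ] at hN
      simpa using hN)
  refine ⟨F, h1, h2, h3, ?_⟩
  rw [Set.univ_prod_univ, Set.inter_univ] at h4
  refine h4.trans (le_of_eq ?_)
  field_simp
  ring

/-! ### From nested families to trees -/

/-- Nested finite families of disjoint clusters, the levels of a hierarchy. -/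
structure IsNestedFamily {S : Type*} [MeasurableSpace S] (L : ℕ → Set (Set S)) : Prop where
  zero : L 0 = {Set.univ}
  finite : ∀ j, (L j).Finite
  measurableSet : ∀ j, ∀ A ∈ L j, MeasurableSet A
  nonempty : ∀ j, ∀ A ∈ L j, A.Nonempty
  pairwiseDisjoint : ∀ j, (L j).PairwiseDisjoint id
  exists_superset : ∀ j, ∀ A ∈ L (j + 1), ∃ B ∈ L j, A ⊆ B

namespace IsNestedFamily

theorem exists_superset_of_le {S : Type*} [MeasurableSpace S] {L : ℕ → Set (Set S)}
    (hL : IsNestedFamily L) {i j : ℕ} (hij : i ≤ j) : ∀ A ∈ L j, ∃ B ∈ L i, A ⊆ B := by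
  induction j, hij using Nat.le_induction with
  | base => exact fun A hA => ⟨A, hA, subset_rfl⟩
  | succ j _ ih =>
    intro A hA
    obtain ⟨B, hB, hAB⟩ := hL.exists_superset j A hA
    obtain ⟨D, hD, hBD⟩ := ih B hB
    exact ⟨D, hD, hAB.trans hBD⟩

theorem subset_of_mem {S : Type*} [MeasurableSpace S] {L : ℕ → Set (Set S)}
    (hL : IsNestedFamily L) {i j : ℕ} (hij : i ≤ j) {A B : Set S} (hA : A ∈ L i)
    (hB : B ∈ L j) {x : S} (hxA : x ∈ A) (hxB : x ∈ B) : B ⊆ A := by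
  obtain ⟨D, hD, hBD⟩ := hL.exists_superset_of_le hij B hB
  rwa [(hL.pairwiseDisjoint i).elim_set hA hD x hxA (hBD hxB)]

/-- The clusters of the levels `0, …, m` of a nested family, tagged with their level. -/
def Cluster {S : Type*} (L : ℕ → Set (Set S)) (m : ℕ) : Type _ :=
  {p : (Fin (m + 1))ᵒᵈ × Set S // p.2 ∈ L (OrderDual.ofDual p.1 : Fin (m + 1))}

instance {S : Type*} (L : ℕ → Set (Set S)) (m : ℕ) : PartialOrder (Cluster L m) :=
  inferInstanceAs (PartialOrder
    {p : (Fin (m + 1))ᵒᵈ × Set S // p.2 ∈ L (OrderDual.ofDual p.1 : Fin (m + 1))})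

namespace Cluster

/-- The level of a cluster. -/
def level {S : Type*} {L : ℕ → Set (Set S)} {m : ℕ} (a : Cluster L m) : ℕ :=
  (OrderDual.ofDual a.1.1 : Fin (m + 1))

/-- The underlying set of a cluster. -/
def carrier {S : Type*} {L : ℕ → Set (Set S)} {m : ℕ} (a : Cluster L m) : Set S := a.1.2

/-- A member of a level, as a cluster. -/
def mk {S : Type*} {L : ℕ → Set (Set S)} {m : ℕ} (j : ℕ) (hj : j ≤ m) (A : Set S) (hA : A ∈ L j) :
    Cluster L m :=
  ⟨(OrderDual.toDual ⟨j, Nat.lt_succ_of_le hj⟩, A), hA⟩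

theorem carrier_mem {S : Type*} {L : ℕ → Set (Set S)} {m : ℕ} (a : Cluster L m) :
    a.carrier ∈ L a.level := a.2

theorem level_le {S : Type*} {L : ℕ → Set (Set S)} {m : ℕ} (a : Cluster L m) : a.level ≤ m :=
  Nat.le_of_lt_succ (OrderDual.ofDual a.1.1).2

theorem le_iff {S : Type*} {L : ℕ → Set (Set S)} {m : ℕ} {a b : Cluster L m} :
    a ≤ b ↔ b.level ≤ a.level ∧ a.carrier ⊆ b.carrier := Iff.rfl

theorem ext {S : Type*} {L : ℕ → Set (Set S)} {m : ℕ} {a b : Cluster L m}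
    (h : a.level = b.level) (h' : a.carrier = b.carrier) : a = b :=
  Subtype.ext (Prod.ext (Fin.ext h) h')

theorem le_or_le_of_mem {S : Type*} [MeasurableSpace S] {L : ℕ → Set (Set S)} {m : ℕ}
    (hL : IsNestedFamily L) {a b : Cluster L m} {x : S} (ha : x ∈ a.carrier)
    (hb : x ∈ b.carrier) : a ≤ b ∨ b ≤ a := by
  rcases le_total a.level b.level with h | h
  · exact Or.inr (le_iff.mpr ⟨h, hL.subset_of_mem h a.carrier_mem b.carrier_mem ha hb⟩)
  · exact Or.inl (le_iff.mpr ⟨h, hL.subset_of_mem h b.carrier_mem a.carrier_mem hb ha⟩)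

end Cluster

/-- The hierarchical clustering given by the levels `0, …, m` of a nested family. -/
def toHierarchicalClustering {S : Type} [MeasurableSpace S] {L : ℕ → Set (Set S)}
    (hL : IsNestedFamily L) (m : ℕ) : HierarchicalClustering S where
  -- The level tag keeps apart equal sets from different levels, which is what makes depth agree
  -- with level.
  Node := Cluster L m
  partialOrder := inferInstance
  orderTop :=
    { top := Cluster.mk 0 (Nat.zero_le m) Set.univ (by rw [hL.zero]; rfl)
      le_top := fun a => Cluster.le_iff.mpr ⟨Nat.zero_le _, Set.subset_univ _⟩ }
  finite := by
    have h : (⋃ j ∈ Set.Iic m, L j).Finite := (Set.finite_Iic m).biUnion fun j _ => hL.finite j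
    have : Finite (⋃ j ∈ Set.Iic m, L j : Set (Set S)) := h
    refine Finite.of_injective (β := Fin (m + 1) × (⋃ j ∈ Set.Iic m, L j : Set (Set S)))
      (fun a : Cluster L m => (OrderDual.ofDual a.1.1, ⟨a.carrier,
        Set.mem_biUnion (Set.mem_Iic.mpr a.level_le) a.carrier_mem⟩)) fun a b hab => ?_
    rw [Prod.mk.injEq, Subtype.mk.injEq] at hab
    exact Cluster.ext (congrArg Fin.val hab.1) hab.2
  isChain_Ici := fun a b hb c hc _ => by
    obtain ⟨x, hx⟩ := hL.nonempty _ _ a.carrier_mem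
    exact Cluster.le_or_le_of_mem hL ((Cluster.le_iff.mp hb).2 hx) ((Cluster.le_iff.mp hc).2 hx)
  cluster := Cluster.carrier
  measurableSet_cluster := fun a => hL.measurableSet _ _ a.carrier_mem
  nonempty_cluster := fun a => hL.nonempty _ _ a.carrier_mem
  cluster_top := rfl
  cluster_subset := fun _ _ h => (Cluster.le_iff.mp h).2
  disjoint_cluster := fun a b hab hba => Set.disjoint_left.mpr fun x hxa hxb =>
    (Cluster.le_or_le_of_mem hL hxa hxb).elim hab hba

/-- Each level before that of `a` has exactly one member containing `a`: one exists by nesting, and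
it is unique by disjointness since `a` is nonempty. -/
theorem depth_toHierarchicalClustering {S : Type} [MeasurableSpace S] {L : ℕ → Set (Set S)}
    (hL : IsNestedFamily L) (m : ℕ) (a : Cluster L m) :
    (hL.toHierarchicalClustering m).depth a = a.level := by
  obtain ⟨x, hx⟩ := hL.nonempty _ _ a.carrier_mem
  have hmem : ∀ b : Cluster L m, a ≤ b → x ∈ b.carrier := fun b hb => (Cluster.le_iff.mp hb).2 hx
  have heq : ∀ b c : Cluster L m, a ≤ b → a ≤ c → b.level = c.level → b = c :=
    fun b c hb hc h => Cluster.ext h (Set.Subset.antisymm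
      (hL.subset_of_mem h.ge c.carrier_mem b.carrier_mem (hmem c hc) (hmem b hb))
      (hL.subset_of_mem h.le b.carrier_mem c.carrier_mem (hmem b hb) (hmem c hc)))
  have himg : Cluster.level '' (Set.Ioi a) = Set.Iio a.level := by
    ext j
    constructor
    · rintro ⟨b, hb, rfl⟩
      refine lt_of_le_of_ne (Cluster.le_iff.mp hb.le).1 fun h => ?_
      exact hb.ne (heq a b le_rfl hb.le h.symm)
    · intro hj
      obtain ⟨B, hB, hAB⟩ := hL.exists_superset_of_le (le_of_lt (Set.mem_Iio.mp hj)) _ a.carrier_mem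
      refine ⟨Cluster.mk j ((le_of_lt (Set.mem_Iio.mp hj)).trans a.level_le) B hB, ?_, rfl⟩
      refine lt_of_le_of_ne (Cluster.le_iff.mpr ⟨le_of_lt (Set.mem_Iio.mp hj), hAB⟩) fun h => ?_
      exact (ne_of_gt (Set.mem_Iio.mp hj)) (congrArg Cluster.level h)
  have hinj : Set.InjOn Cluster.level (Set.Ioi a) :=
    fun b hb c hc h => heq b c (le_of_lt hb) (le_of_lt hc) h
  change (Set.Ioi a).ncard = a.level
  rw [← hinj.ncard_image, himg, Set.ncard_eq_toFinset_card']
  simp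

theorem depth_smallest {S : Type} [MeasurableSpace S] {L : ℕ → Set (Set S)}
    (hL : IsNestedFamily L) {m d : ℕ} (hd : d ≤ m) {x y : S}
    (h : ∀ j ≤ m, (x, y) ∈ sameMember (L j) ↔ j ≤ d) :
    (hL.toHierarchicalClustering m).depth ((hL.toHierarchicalClustering m).smallest x y) = d := by
  have hleast := (hL.toHierarchicalClustering m).isLeast_smallest x y
  generalize (hL.toHierarchicalClustering m).smallest x y = a at hleast
  change Cluster L m at a
  rw [hL.depth_toHierarchicalClustering m a]
  apply le_antisymm
  · exact (h a.level a.level_le).mp (mem_sameMember.mpr ⟨a.carrier, a.carrier_mem, hleast.1⟩)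
  · obtain ⟨A, hA, hxy⟩ := mem_sameMember.mp ((h d hd).mpr le_rfl)
    exact (Cluster.le_iff.mp (hleast.2 (show Cluster.mk d hd A hA ∈ _ from hxy))).1

end IsNestedFamily

/-- The common refinements of the first members of a sequence of families. -/
def commonRefinement {S : Type*} (F : ℕ → Set (Set S)) : ℕ → Set (Set S)
  | 0 => {Set.univ}
  | j + 1 => {A | A.Nonempty ∧ A ∈ Set.image2 (· ∩ ·) (commonRefinement F j) (F j)}

/-- Level `j` involves only the families of index below `j`. These need not cover the space: a point
outside a family's members is simply in no cluster of the later levels. -/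
theorem sameMember_commonRefinement {S : Type*} (F : ℕ → Set (Set S)) (j : ℕ) (p : S × S) :
    p ∈ sameMember (commonRefinement F j) ↔ ∀ i < j, p ∈ sameMember (F i) := by
  induction j with
  | zero => simp [mem_sameMember, commonRefinement]
  | succ j ih =>
    rw [Nat.forall_lt_succ_right, ← ih]
    simp only [mem_sameMember]
    constructor
    · rintro ⟨_, ⟨-, A, hA, B, hB, rfl⟩, h1, h2⟩
      exact ⟨⟨A, hA, h1.1, h2.1⟩, ⟨B, hB, h1.2, h2.2⟩⟩
    · rintro ⟨⟨A, hA, h1, h2⟩, ⟨B, hB, h3, h4⟩⟩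
      exact ⟨A ∩ B, ⟨⟨p.1, h1, h3⟩, A, hA, B, hB, rfl⟩, ⟨h1, h3⟩, ⟨h2, h4⟩⟩

theorem isNestedFamily_commonRefinement {S : Type*} [MeasurableSpace S] [Nonempty S]
    {F : ℕ → Set (Set S)} (hfin : ∀ j, (F j).Finite) (hmeas : ∀ j, ∀ A ∈ F j, MeasurableSet A)
    (hdisj : ∀ j, (F j).PairwiseDisjoint id) : IsNestedFamily (commonRefinement F) where
  zero := rfl
  finite j := by
    induction j with
    | zero => exact Set.finite_singleton _
    | succ j ih => exact (ih.image2 _ (hfin j)).subset fun A hA => hA.2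
  measurableSet j := by
    induction j with
    | zero => rintro A rfl; exact MeasurableSet.univ
    | succ j ih =>
      rintro _ ⟨-, A, hA, B, hB, rfl⟩
      exact (ih A hA).inter (hmeas j B hB)
  nonempty j := by
    cases j with
    | zero => rintro A rfl; exact Set.univ_nonempty
    | succ j => exact fun A hA => hA.1
  pairwiseDisjoint j := by
    induction j with
    | zero => exact Set.pairwiseDisjoint_singleton _ _
    | succ j ih =>
      rintro _ ⟨-, A, hA, B, hB, rfl⟩ _ ⟨-, A', hA', B', hB', rfl⟩ hne
      refine Set.disjoint_left.mpr fun x hx hx' => hne ?_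
      rw [ih.elim_set hA hA' x hx.1 hx'.1, (hdisj j).elim_set hB hB' x hx.2 hx'.2]
  exists_superset j := by
    rintro _ ⟨-, A, hA, B, hB, rfl⟩
    exact ⟨A, hA, Set.inter_subset_left⟩

/-- The smallest node is `a` exactly when both points lie in the cluster of `a` and in no common
cluster of a node that is not above `a`; there are finitely many nodes. -/
theorem HierarchicalClustering.measurable_comp_smallest {S : Type*} [MeasurableSpace S]
    (H : HierarchicalClustering S) (q : H.Node → ℝ) :
    Measurable fun p : S × S => q (H.smallest p.1 p.2) := by
  have hfib : ∀ a : H.Node, MeasurableSet {p : S × S | H.smallest p.1 p.2 = a} := by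
    intro a
    have heq : {p : S × S | H.smallest p.1 p.2 = a} =
        (H.cluster a ×ˢ H.cluster a) ∩
          ⋂ b ∈ {b : H.Node | ¬ a ≤ b}, (H.cluster b ×ˢ H.cluster b)ᶜ := by
      ext p
      have hl := H.isLeast_smallest p.1 p.2
      simp only [Set.mem_ofPred_eq, Set.mem_inter_iff, Set.mem_iInter, Set.mem_compl_iff,
        Set.mem_prod]
      constructor
      · rintro rfl
        exact ⟨hl.1, fun b hb hp => hb (hl.2 hp)⟩
      · rintro ⟨ha, hb⟩
        refine le_antisymm (hl.2 ha) ?_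
        by_contra hn
        exact hb _ hn hl.1
    rw [heq]
    refine ((H.measurableSet_cluster a).prod (H.measurableSet_cluster a)).inter ?_
    exact (Set.toFinite _).measurableSet_biInter fun b _ =>
      ((H.measurableSet_cluster b).prod (H.measurableSet_cluster b)).compl
  intro t _
  have heq : (fun p : S × S => q (H.smallest p.1 p.2)) ⁻¹' t =
      ⋃ a ∈ q ⁻¹' t, {p : S × S | H.smallest p.1 p.2 = a} := by
    ext p; simp
  rw [heq]
  exact (Set.toFinite _).measurableSet_biUnion fun a _ => hfib a

/-! ### Thresholds and the deterministic statement -/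

/-- Among `K` consecutive windows of width `w / K`, one carries mass at most `1 / K`. -/
theorem exists_threshold {X : Type*} [MeasurableSpace X] (ρ : Measure X) [IsProbabilityMeasure ρ]
    {g : X → ℝ} (hg : Measurable g) (s : ℝ) {w : ℝ} (hw : 0 < w) {K : ℕ} (hK : 0 < K) :
    ∃ t, s < t ∧ t ≤ s + w ∧ ρ.real {x | t - w / K ≤ g x ∧ g x < t} ≤ 1 / K := by
  by_contra! h
  have hK' : (0 : ℝ) < K := Nat.cast_pos.mpr hK
  have hc : 0 < w / K := by positivity
  have hcK : w / K * K = w := by field_simp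
  set c := w / K
  set B : ℕ → Set X := fun i => {x | s + (i + 1) * c - c ≤ g x ∧ g x < s + (i + 1) * c} with hB
  have hlt : ∀ i ∈ Finset.range K, 1 / (K : ℝ) < ρ.real (B i) := by
    intro i hi
    have hi' : (i : ℝ) + 1 ≤ K := by exact_mod_cast Finset.mem_range.mp hi
    refine h _ (by nlinarith [(Nat.cast_nonneg i : (0 : ℝ) ≤ i)]) ?_
    nlinarith
  have hmeas : ∀ i ∈ Finset.range K, MeasurableSet (B i) := fun i _ =>
    (measurableSet_le measurable_const hg).inter (measurableSet_lt hg measurable_const)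
  have haux : ∀ i j : ℕ, ∀ x, x ∈ B i → x ∈ B j → i ≤ j := by
    intro i j x hi hj
    by_contra! hji
    have : (j : ℝ) + 1 ≤ i := by exact_mod_cast hji
    have h1 := hi.1
    have h2 := hj.2
    nlinarith
  have hdisj : Set.PairwiseDisjoint (↑(Finset.range K)) B := fun i _ j _ hij =>
    Set.disjoint_left.mpr fun x hi hj => hij (le_antisymm (haux i j x hi hj) (haux j i x hj hi))
  have hsum := measureReal_biUnion_finset (μ := ρ) hdisj hmeas
  have hle : ρ.real (⋃ i ∈ Finset.range K, B i) ≤ 1 := measureReal_le_one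
  have := Finset.sum_lt_sum_of_nonempty (Finset.nonempty_range_iff.mpr hK.ne') hlt
  rw [← hsum, Finset.sum_const, Finset.card_range, nsmul_eq_mul, mul_one_div_cancel hK'.ne'] at this
  linarith

/-- The triples that violate the ultrametric inequality for `g` by more than `κ`. -/
def ultrametricDefects {S : Type*} (g : S × S → ℝ) (κ : ℝ) : Set (S × S × S) :=
  {s | g (s.1, s.2.1) < min (g (s.1, s.2.2)) (g (s.2.1, s.2.2)) - κ}

/-- In a cherry both values at the third point are at least `t`. If the remaining value is below `t
- c`, the triple violates ultrametricity by more than `κ`; otherwise that value lies in the window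
below `t`. -/
theorem measureReal_cherries_le {S : Type*} [MeasurableSpace S] (ν : Measure S)
    [IsProbabilityMeasure ν] {g : S × S → ℝ} (hg : Measurable g) {κ c t : ℝ} (hκ : κ ≤ c) :
    (ν.prod (ν.prod ν)).real (cherries {p | t ≤ g p}) ≤
      (ν.prod (ν.prod ν)).real (ultrametricDefects g κ) +
        (ν.prod ν).real {p | t - c ≤ g p ∧ g p < t} := by
  have hm : MeasurableSet {p | t - c ≤ g p ∧ g p < t} :=
    (measurableSet_le measurable_const hg).inter (measurableSet_lt hg measurable_const)
  have hpres : MeasurePreserving (fun s : S × S × S => (s.1, s.2.1))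
      (ν.prod (ν.prod ν)) (ν.prod ν) :=
    (MeasurePreserving.id ν).prod (measurePreserving_fst (μ := ν) (ν := ν))
  rw [← hpres.measureReal_preimage hm.nullMeasurableSet]
  refine (measureReal_mono ?_).trans (measureReal_union_le _ _)
  rintro s ⟨h13, h23, h12⟩
  simp only [Set.mem_ofPred_eq, not_le] at h13 h23 h12
  rcases lt_or_ge (g (s.1, s.2.1)) (t - c) with h | h
  · left
    change g (s.1, s.2.1) < min (g (s.1, s.2.2)) (g (s.2.1, s.2.2)) - κ
    have := le_min h13 h23
    linarith
  · exact Or.inr ⟨h, h12⟩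

/-- `g` is within `η` in mean of a function of the depth of the smallest common cluster. -/
def IsHierarchical {S : Type} [MeasurableSpace S] (ν : Measure S) (g : S × S → ℝ) (η : ℝ) : Prop :=
  ∃ (H : HierarchicalClustering S) (q : H.Node → ℝ),
    (∀ a b, H.depth a = H.depth b → q a = q b) ∧
    Integrable (fun s : S × S => |g s - q (H.smallest s.1 s.2)|) (ν.prod ν) ∧
    ∫ s : S × S, |g s - q (H.smallest s.1 s.2)| ∂(ν.prod ν) ≤ η

theorem IsHierarchical.mono {S : Type} [MeasurableSpace S] {ν : Measure S} {g : S × S → ℝ}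
    {η η' : ℝ} (h : IsHierarchical ν g η) (hη : η ≤ η') : IsHierarchical ν g η' := by
  obtain ⟨H, q, h1, h2, h3⟩ := h
  exact ⟨H, q, h1, h2, h3.trans hη⟩

/-- Inside the range, `t (d - 1) ≤ v < t d` locates `v`. At the ends `d = 0` and `d = m`, the
missing threshold is replaced by `-C ≤ v` and `v ≤ C ≤ -C + m * w`. -/
theorem abs_sub_level_le {C w : ℝ} {m : ℕ} (hm : 2 * C ≤ m * w) {t : ℕ → ℝ}
    (ht : ∀ i : ℕ, -C + i * w < t i ∧ t i ≤ -C + i * w + w) {v : ℝ} (hv : |v| ≤ C) (hw : 0 < w)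
    {d : ℕ} (hdm : d ≤ m) (hd : ∀ j ≤ m, (∀ i < j, t i ≤ v) ↔ j ≤ d) : |v - (-C + d * w)| ≤ w := by
  obtain ⟨hv1, hv2⟩ := abs_le.mp hv
  rw [abs_le]
  constructor
  · rcases d with _ | d
    · simp; linarith
    · have h1 := (hd (d + 1) hdm).mpr le_rfl d (Nat.lt_succ_self d)
      have h2 := (ht d).1
      push_cast
      linarith
  · rcases hdm.lt_or_eq with h | rfl
    · have h1 : ¬ ∀ i < d + 1, t i ≤ v := fun h' => by
        have := (hd (d + 1) h).mp h'
        omega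
      rw [Nat.forall_lt_succ_right] at h1
      have h2 : ¬ t d ≤ v := fun h' => h1 ⟨(hd d hdm).mpr le_rfl, h'⟩
      have h3 := (ht d).2
      linarith
    · linarith

theorem exists_depth (p : ℕ → Prop) (m : ℕ) : ∃ d ≤ m, ∀ j ≤ m, (∀ i < j, p i) ↔ j ≤ d := by
  classical
  refine ⟨Nat.findGreatest (fun j => ∀ i < j, p i) m, Nat.findGreatest_le m, fun j hj => ?_⟩
  refine ⟨fun h => Nat.le_findGreatest hj h, fun h i hi => ?_⟩
  exact Nat.findGreatest_spec (P := fun j => ∀ i < j, p i) (Nat.zero_le m) (by simp) i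
    (hi.trans_le h)

/-- A bounded function with few ultrametric defects is nearly hierarchical. -/
theorem exists_isHierarchical {C : ℝ} (hC : 0 ≤ C) {η : ℝ} (hη : 0 < η) :
    ∃ κ : ℝ, 0 < κ ∧ ∀ (S : Type) [MeasurableSpace S] (ν : Measure S) [IsProbabilityMeasure ν]
      (g : S × S → ℝ), Measurable g → (∀ p, |g p| ≤ C) → (∀ x y, g (x, y) = g (y, x)) →
      (ν.prod (ν.prod ν)).real (ultrametricDefects g κ) ≤ κ → IsHierarchical ν g η := by
  set w := η / 2 with hw_def
  have hw : 0 < w := half_pos hη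
  obtain ⟨m, hm⟩ := exists_nat_ge (2 * C / w)
  rw [div_le_iff₀ hw] at hm
  -- `M` bounds the error on exceptional pairs, and `e` makes their total contribution `m * e * M`
  -- at most `w`. The other pairs contribute at most `w = η / 2`.
  set M := 2 * C + m * w + 1 with hM_def
  have hM : 0 < M := by positivity
  set e := w / ((m + 1) * M) with he_def
  have he : 0 < e := by positivity
  obtain ⟨κ₀, hκ₀, hclasses⟩ := exists_classes he
  obtain ⟨K, hK⟩ := exists_nat_gt (2 / κ₀)
  have hK' : (0 : ℝ) < K := lt_trans (by positivity) hK
  -- Ultrametric defects and the window each get half of the allowed cherry mass `κ₀`; `κ ≤ w / K`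
  -- keeps the slack within the window's width.
  refine ⟨min (κ₀ / 2) (w / K), by positivity, fun S _ ν _ g hg hgC hsymm hdef => ?_⟩
  choose t ht1 ht2 ht3 using fun i : ℕ =>
    exists_threshold (ν.prod ν) hg (-C + i * w) hw (Nat.cast_pos.mp hK')
  set W : ℕ → Set (S × S) := fun i => {p | t i ≤ g p} with hW
  have hcherry : ∀ i, (ν.prod (ν.prod ν)).real (cherries (W i)) ≤ κ₀ := by
    intro i
    have h1 := measureReal_cherries_le ν hg (t := t i) (min_le_right (κ₀ / 2) (w / K))
    have h2 := min_le_left (κ₀ / 2) (w / K)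
    have h3 : 1 / (K : ℝ) ≤ κ₀ / 2 := by
      rw [div_lt_iff₀ hκ₀] at hK
      rw [div_le_iff₀ hK']
      linarith
    have h4 := ht3 i
    linarith
  choose F hfin hmeas hdisj hdist using fun i => hclasses S ν (W i)
    (measurableSet_le measurable_const hg) (fun x y h => by
      change t i ≤ g (y, x)
      rw [← hsymm x y]; exact h) (hcherry i)
  have : Nonempty S := ν.nonempty_of_neZero
  have hL := isNestedFamily_commonRefinement hfin hmeas hdisj
  set H := hL.toHierarchicalClustering m with hH
  set q : H.Node → ℝ := fun a => -C + H.depth a * w with hq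
  set B : Set (S × S) := ⋃ i ∈ Finset.range m, symmDiff (W i) (sameMember (F i)) with hB
  have hBm : MeasurableSet B := Finset.measurableSet_biUnion _ fun i _ =>
    (measurableSet_le measurable_const hg).symmDiff (measurableSet_sameMember (hfin i) (hmeas i))
  have hBle : (ν.prod ν).real B ≤ m * e := by
    refine (measureReal_biUnion_finset_le _ _).trans ?_
    refine (Finset.sum_le_sum fun i _ => hdist i).trans ?_
    simp
  have hdepth : ∀ a : H.Node, (H.depth a : ℝ) ≤ m := fun a => by
    exact_mod_cast (hL.depth_toHierarchicalClustering m a).trans_le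
      (IsNestedFamily.Cluster.level_le _)
  have hpt : ∀ p : S × S, |g p - q (H.smallest p.1 p.2)| ≤ w + B.indicator (fun _ => M) p := by
    intro p
    by_cases hp : p ∈ B
    · rw [Set.indicator_of_mem hp]
      have h1 := abs_le.mp (hgC p)
      have h2 := hdepth (H.smallest p.1 p.2)
      have h3 : (0 : ℝ) ≤ H.depth (H.smallest p.1 p.2) := Nat.cast_nonneg _
      have h4 := mul_le_mul_of_nonneg_right h2 hw.le
      have h5 := mul_nonneg h3 hw.le
      rw [abs_le]
      constructor <;> simp only [hq] <;> linarith
    · rw [Set.indicator_of_notMem hp, add_zero]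
      obtain ⟨d, hdm, hd⟩ := exists_depth (fun i => t i ≤ g p) m
      have heq : ∀ i < m, p ∈ sameMember (F i) ↔ t i ≤ g p := by
        intro i hi
        by_contra hcon
        refine hp (Set.mem_biUnion (Finset.mem_coe.mpr (Finset.mem_range.mpr hi)) ?_)
        rw [Set.mem_symmDiff]
        change (t i ≤ g p ∧ _) ∨ (_ ∧ ¬ t i ≤ g p)
        tauto
      have hdep : H.depth (H.smallest p.1 p.2) = d := by
        refine hL.depth_smallest hdm fun j hj => ?_
        rw [sameMember_commonRefinement, ← hd j hj]
        exact forall₂_congr fun i hi => heq i (hi.trans_le hj)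
      simp only [hq, hdep]
      exact abs_sub_level_le hm (fun i => ⟨ht1 i, ht2 i⟩) (hgC p) hw hdm hd
  have hqm := (hg.sub (H.measurable_comp_smallest q)).abs
  have hi2 : Integrable (fun p => w + B.indicator (fun _ => M) p) (ν.prod ν) :=
    (integrable_const w).add ((integrable_const M).indicator hBm)
  have hi1 : Integrable (fun p : S × S => |g p - q (H.smallest p.1 p.2)|) (ν.prod ν) :=
    hi2.mono' hqm.aestronglyMeasurable (ae_of_all _ fun p => by
      rw [Real.norm_eq_abs, abs_abs]; exact hpt p)
  refine ⟨H, q, fun a b hab => by simp only [hq, hab], hi1, (integral_mono hi1 hi2 hpt).trans ?_⟩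
  rw [integral_add (integrable_const w) ((integrable_const M).indicator hBm),
    integral_indicator_const _ hBm]
  simp only [integral_const, probReal_univ, smul_eq_mul, one_mul]
  have h1 : (ν.prod ν).real B * M ≤ m * e * M := mul_le_mul_of_nonneg_right hBle hM.le
  have h2 : m * e * M ≤ (m + 1) * e * M := by
    gcongr
    linarith
  have h3 : (m + 1) * e * M = w := by
    rw [he_def]; field_simp
  have h4 : w + w = η := add_halves η
  linarith

/-- Every bounded function is trivially hierarchical, with an error of the order of its bound. -/
theorem isHierarchical_of_bounded {S : Type} [MeasurableSpace S] (ν : Measure S)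
    [IsProbabilityMeasure ν] {g : S × S → ℝ} (hg : Measurable g) {C : ℝ} (hgC : ∀ p, |g p| ≤ C) :
    IsHierarchical ν g C := by
  have : Nonempty S := ν.nonempty_of_neZero
  have hL := isNestedFamily_commonRefinement (S := S) (F := fun _ => ∅) (by simp) (by simp)
    (by simp)
  have hi : Integrable g (ν.prod ν) :=
    Integrable.of_bound hg.aestronglyMeasurable C (ae_of_all _ hgC)
  refine ⟨hL.toHierarchicalClustering 0, fun _ => 0, fun _ _ _ => rfl, by simpa using hi.abs, ?_⟩
  simp only [sub_zero]
  refine (integral_mono hi.abs (integrable_const C) hgC).trans ?_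
  simp

/-! ### Null sequences and the random measure -/

/-- If `Q n` is upward closed, nonempty, and eventually contains every positive number, then some
null sequence satisfies it for all `n`. -/
theorem exists_tendsto_zero_of_eventually {Q : ℕ → ℝ → Prop} (hmono : ∀ n a b, a ≤ b → Q n a → Q n b)
    (hne : ∃ M, ∀ n, Q n M) (hev : ∀ η > 0, ∀ᶠ n in atTop, Q n η) :
    ∃ u : ℕ → ℝ, Tendsto u atTop (𝓝 0) ∧ ∀ n, Q n (u n) := by
  obtain ⟨M, hM⟩ := hne
  set I : ℕ → Set ℝ := fun n => {a | 0 < a ∧ Q n a} with hI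
  have hIne : ∀ n, (I n).Nonempty := fun n =>
    ⟨max M 1, lt_max_of_lt_right one_pos, hmono n _ _ (le_max_left _ _) (hM n)⟩
  have hIbdd : ∀ n, BddBelow (I n) := fun n => ⟨0, fun a ha => ha.1.le⟩
  have hpos : ∀ n : ℕ, (0 : ℝ) < 1 / ((n : ℝ) + 1) := fun n => Nat.one_div_pos_of_nat
  -- The infimum need not be attained, so a vanishing positive amount is added.
  refine ⟨fun n => sInf (I n) + 1 / ((n : ℝ) + 1), ?_, fun n => ?_⟩
  · have h0 : Tendsto (fun n => sInf (I n)) atTop (𝓝 0) := by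
      rw [Metric.tendsto_atTop']
      intro r hr
      obtain ⟨N, hN⟩ := eventually_atTop.mp (hev (r / 2) (half_pos hr))
      refine ⟨N, fun n hn => ?_⟩
      have h1 : sInf (I n) ≤ r / 2 := csInf_le (hIbdd n) ⟨half_pos hr, hN n hn.le⟩
      have h2 : 0 ≤ sInf (I n) := le_csInf (hIne n) fun a ha => ha.1.le
      rw [Real.dist_eq, sub_zero, abs_of_nonneg h2]
      linarith
    simpa using h0.add tendsto_one_div_add_atTop_nhds_zero_nat
  · obtain ⟨a, ha, hlt⟩ := exists_lt_of_csInf_lt (hIne n) (lt_add_of_pos_right (sInf (I n)) (hpos n))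
    exact hmono n _ _ hlt.le ha.2

theorem measurable_overlap {k : SpinKind} {n : ℕ} :
    Measurable fun s : configSpace k n × configSpace k n => overlap s.1 s.2 := by
  refine Measurable.subtype_mk ?_
  fun_prop

theorem overlap_comm {k : SpinKind} {n : ℕ} (σ τ : configSpace k n) :
    overlap σ τ = overlap τ σ := by
  simp only [overlap, mul_comm]

/-- Under the ansatz, the mass of the ultrametric defects is small with probability close to one. -/
theorem GeneralizedParisiAnsatz.eventually_exists_event {Ω : ℕ → Type*}
    [∀ n, MeasurableSpace (Ω n)] {P : ∀ n, Measure (Ω n)} [∀ n, IsProbabilityMeasure (P n)]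
    {k : ℕ → SpinKind} {μ : ∀ n, Kernel (Ω n) (configSpace (k n) n)} [∀ n, IsMarkovKernel (μ n)]
    {f : Set.Icc (-1 : ℝ) 1 → ℝ} (hf : Measurable f) (h : GeneralizedParisiAnsatz P k μ f)
    {κ η : ℝ} (hκ : 0 < κ) (hη : 0 < η) :
    ∀ᶠ n in atTop, ∃ A : Set (Ω n), MeasurableSet A ∧ 1 - η ≤ (P n).real A ∧
      ∀ ω ∈ A, ((μ n ω).prod ((μ n ω).prod (μ n ω))).real
        (ultrametricDefects (fun s => f (overlap s.1 s.2)) κ) ≤ κ := by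
  have hlim := h κ hκ
  -- The expected defect mass is eventually below `κ * η`, so by Markov it reaches `κ` with
  -- probability at most `η`.
  filter_upwards [hlim.eventually (lt_mem_nhds (show 1 - κ * η < 1 by
    have := mul_pos hκ hη; linarith))] with n hn
  set g : configSpace (k n) n × configSpace (k n) n → ℝ := fun s => f (overlap s.1 s.2) with hg_def
  have hg : Measurable g := hf.comp measurable_overlap
  have hDm : MeasurableSet (ultrametricDefects g κ) := by
    have h12 : Measurable fun s : configSpace (k n) n × configSpace (k n) n × configSpace (k n) n =>
      g (s.1, s.2.1) := hg.comp (by fun_prop)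
    have h13 : Measurable fun s : configSpace (k n) n × configSpace (k n) n × configSpace (k n) n =>
      g (s.1, s.2.2) := hg.comp (by fun_prop)
    have h23 : Measurable fun s : configSpace (k n) n × configSpace (k n) n × configSpace (k n) n =>
      g (s.2.1, s.2.2) := hg.comp (by fun_prop)
    exact measurableSet_lt h12 ((h13.min h23).sub_const κ)
  have hcompl : {s : configSpace (k n) n × configSpace (k n) n × configSpace (k n) n |
      min (f (overlap s.1 s.2.2)) (f (overlap s.2.1 s.2.2)) - κ ≤ f (overlap s.1 s.2.1)} =
      (ultrametricDefects g κ)ᶜ := by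
    ext s
    simp [ultrametricDefects, hg_def]
  set G : Ω n → ℝ := fun ω =>
    ((μ n ω).prod ((μ n ω).prod (μ n ω))).real (ultrametricDefects g κ) with hG
  have hGm : Measurable G := by
    have h1 := (Kernel.measurable_coe (μ n ×ₖ (μ n ×ₖ μ n)) hDm).ennreal_toReal
    simp only [Kernel.prod_apply] at h1
    exact h1
  have hGi : Integrable G (P n) := by
    refine Integrable.of_bound hGm.aestronglyMeasurable 1 (ae_of_all _ fun ω => ?_)
    rw [Real.norm_of_nonneg measureReal_nonneg]
    exact measureReal_le_one
  have hinner : ∀ ω, ∫ s : configSpace (k n) n × configSpace (k n) n × configSpace (k n) n,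
      Set.indicator {s | min (f (overlap s.1 s.2.2)) (f (overlap s.2.1 s.2.2)) - κ
        ≤ f (overlap s.1 s.2.1)} (fun _ => (1 : ℝ)) s
      ∂((μ n ω).prod ((μ n ω).prod (μ n ω))) = 1 - G ω := by
    intro ω
    rw [hcompl, integral_indicator_const _ hDm.compl, probReal_compl_eq_one_sub hDm]
    simp [hG]
  simp only [hinner] at hn
  rw [integral_sub (integrable_const 1) hGi] at hn
  simp only [integral_const, probReal_univ, smul_eq_mul, mul_one] at hn
  have hmarkov := mul_meas_ge_le_integral_of_nonneg
    (ae_of_all (P n) fun ω => (measureReal_nonneg : 0 ≤ G ω)) hGi κ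
  have hAm : MeasurableSet {ω | κ ≤ G ω} := measurableSet_le measurable_const hGm
  refine ⟨{ω | κ ≤ G ω}ᶜ, hAm.compl, ?_, fun ω hω =>
    (not_le.mp (show ¬ κ ≤ G ω from hω)).le⟩
  rw [probReal_compl_eq_one_sub hAm]
  have : (P n).real {ω | κ ≤ G ω} ≤ η := by
    refine le_of_mul_le_mul_left (hmarkov.trans ?_) hκ
    linarith
  linarith

theorem mainTheorem3 {Ω : ℕ → Type*} [∀ n, MeasurableSpace (Ω n)]
    (P : ∀ n, Measure (Ω n)) [∀ n, IsProbabilityMeasure (P n)]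
    (k : ℕ → SpinKind)
    (μ : ∀ n, Kernel (Ω n) (configSpace (k n) n)) [∀ n, IsMarkovKernel (μ n)]
    (f : Set.Icc (-1 : ℝ) 1 → ℝ) (hf_meas : Measurable f) (hf_bdd : ∃ C : ℝ, ∀ x, |f x| ≤ C)
    (h_ansatz : GeneralizedParisiAnsatz P k μ f) :
    ∃ ε δ : ℕ → ℝ, Tendsto ε atTop (𝓝 0) ∧ Tendsto δ atTop (𝓝 0) ∧
      ∀ n, ∃ A : Set (Ω n), MeasurableSet A ∧ 1 - ε n ≤ (P n).real A ∧
        ∀ ω ∈ A, ∃ (H : HierarchicalClustering (configSpace (k n) n)) (q : H.Node → ℝ),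
          (∀ a b, H.depth a = H.depth b → q a = q b) ∧
          Integrable
            (fun s : configSpace (k n) n × configSpace (k n) n =>
              |f (overlap s.1 s.2) - q (H.smallest s.1 s.2)|) ((μ n ω).prod (μ n ω)) ∧
          ∫ s : configSpace (k n) n × configSpace (k n) n,
              |f (overlap s.1 s.2) - q (H.smallest s.1 s.2)| ∂((μ n ω).prod (μ n ω)) ≤ δ n := by

  obtain ⟨C, hC⟩ := hf_bdd
  have hC0 : 0 ≤ C := (abs_nonneg _).trans (hC ⟨0, by norm_num⟩)
  obtain ⟨u, hu, hQ⟩ := exists_tendsto_zero_of_eventually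
    (Q := fun n η => ∃ A : Set (Ω n), MeasurableSet A ∧ 1 - η ≤ (P n).real A ∧
      ∀ ω ∈ A, IsHierarchical (μ n ω) (fun s => f (overlap s.1 s.2)) η)
    (fun n a b hab ⟨A, hA, hPA, h⟩ => ⟨A, hA, by linarith, fun ω hω => (h ω hω).mono hab⟩)
    -- For the finitely many `n` that the limit does not control, the one-cluster tree with value 0
    -- has error at most `C`.
    ⟨max C 1, fun n => ⟨Set.univ, MeasurableSet.univ, by
      rw [probReal_univ]
      linarith [le_max_right C 1], fun ω _ =>
        (isHierarchical_of_bounded (μ n ω) (hf_meas.comp measurable_overlap)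
          fun _ => hC _).mono (le_max_left _ _)⟩⟩
    (fun η hη => by
      obtain ⟨κ, hκ, hκ'⟩ := exists_isHierarchical hC0 hη
      filter_upwards [h_ansatz.eventually_exists_event hf_meas hκ hη] with n ⟨A, hA, hPA, h⟩
      exact ⟨A, hA, hPA, fun ω hω => hκ' _ (μ n ω) _ (hf_meas.comp measurable_overlap)
        (fun _ => hC _) (fun x y => congrArg f (overlap_comm x y)) (h ω hω)⟩)
  exact ⟨u, u, hu, hu, hQ⟩
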